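/- **Model (TSO).** There are $n$ processes $i$, each with a local dispatcher $d_i$; processes and dispatchers are the *agents*. A state consists of a main memory (a value for each variable), a FIFO store buffer of pairs $\langle x,v\rangle$ for each process, and a local state for each process. The possible events are the following. * Process $i$ performs $\mathtt W(x,v)$: $\langle x,v\rangle$ is appended to its buffer. * Process $i$ reads $x$: from its buffer ($\mathtt{RfB}(x,v)$, where $v$ is the latest value for $x$ in the buffer) if the buffer holds an item for $x$, and otherwise from memory ($\mathtt{RfM}(x,v)$). * Process $i$ performs a fence $\mathtt F$ (enabled only if its buffer is empty), or $\mathtt{RMW}(x,v_{\exp},v_{\rm new})$ (enabled only if its buffer is empty and $x$ has value $v_{\exp}$ in memory; it sets $x$ to $v_{\rm new}$ in memory), or an internal action, or $\mathtt{return}(O)$, or the null action $\bot$. * Dispatcher $d_i$ performs $\mathtt{prop}(x,v)$ (the oldest item $\langle x,v\rangle$ of the buffer of $i$ is removed and written to memory), or $\bot$. $\mathtt{RfM}(x,\cdot)$, $\mathtt{RMW}(x,\cdot,\cdot)$ and $\mathtt{prop}(x,\cdot)$ are the *memory accesses* of $x$. Two memory accesses of the same variable by different agents *conflict* unless both are $\mathtt{RfM}$,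 or one is a $\mathtt{prop}$ of some $d_i$ and the other an $\mathtt{RfM}$ of the same $i$. The local state of a process is the list of its non-null events (a read is recorded as $\mathtt R(x,v)$, without its source) and of the invocations it received. A protocol $P$ assigns to each process and local state a nonempty set of actions. A *run* of $P$ is an infinite sequence $r(0),r(1),\dots$ of states, starting with empty buffers and empty local states, in which $r(t+1)$ results from $r(t)$ by one event (possibly $\bot$) of each agent, each enabled in $r(t)$ and pairwise non-conflicting, carried out in the order processes, then dispatchers, and by at most one invocation $\mathtt{invoke}(i,O)$ by the environment per process $i$; non-null actions of processes are taken from $P$, and a process is not invoked again before it has performed the matching return. The event that agent $b$ performs in the round from $t$ to $t+1$ is the event at the *node* $\langle b,t\rangle$. **Convention.** In all runs considered, an item is never read from the buffer of $i$ in the same round in which $d_i$ propagates it. **Occurs before.** $\overset{ob}\rightsquigarrow_r$ is the least transitive relation on nodes such that, for $t<t'$: 1. $\langle b,t\rangle\overset{ob}\rightsquigarrow_r\langle b,t'\rangle$ for every agent $b$; 2. $\langle i,t\rangle\overset{ob}\rightsquigarrow_r\langle d_i,t'\rangle$ if $i$ writes, or reads from its buffer, at $t$ the very item that $d_i$ propagates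 at $t'$; 3. $\langle b,t\rangle\overset{ob}\rightsquigarrow_r\langle c,t'\rangle$ if the events at both nodes are memory accesses of the same variable, except if both are $\mathtt{RfM}$, or if $b=d_i$, $c=i$ for some $i$, the first is a $\mathtt{prop}$ and the second an $\mathtt{RfM}$; 4. $\langle d_i,t\rangle\overset{ob}\rightsquigarrow_r\langle i,t'\rangle$ if the event at the first node is a $\mathtt{prop}$ and the one at the second is $\mathtt F$ or an $\mathtt{RMW}$. **Operations.** An operation $X$ of process $i$ occurs in $r$ between $X.s=\langle i,s\rangle$ and $X.e=\langle i,e\rangle$ if it is invoked in the round from $s$ to $s+1$ and its matching return is performed in the round from $e-1$ to $e$. It *contains a feedback loop* in $r$ if $X.s\overset{ob}\rightsquigarrow_r\langle b,t\rangle\overset{ob}\rightsquigarrow_r X.e$ for some node $\langle b,t\rangle$ with $b\notin\{i,d_i\}$. It *runs solo* in $r$ if no agent other than $i$ and $d_i$ performs a non-null action at a time $t$ with $s\le t\le e$. Runs $r,\tilde r$ are *locally equivalent*, $r\approx\tilde r$, if for every process the same local states appear in $r$ and in $\tilde r$. **Theorem.** Let $r$ be a run of a protocol $P$ and let $X$ be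 an operation that occurs in $r$ and contains no feedback loop in $r$. Then there is a run $\tilde r\approx r$ of $P$, with the same initial state as $r$, in which $X$ (the same invocation of the same process) occurs and runs solo. Moreover $\tilde r$ can be chosen such that it inherits from $r$ each of the two fairness conditions: every nonempty buffer is eventually propagated from; every process that from some time on always has an enabled non-null action of its protocol eventually moves. -/

import Mathlib

namespace TSO

/-- Agents of a system with `n` processes: the processes `i` and their local dispatchers `d_i`. -/
inductive Agent (n : ℕ) where
  | proc (i : Fin n)
  | disp (i : Fin n)

/-- The actions that a protocol can prescribe to a process: `R[x]`, `W[x,v]`, `F`,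
`RMW[x,v_exp,v_new]`, the null action, internal actions, and `return(O)`. -/
inductive Action (Var Val Op Intl : Type*) where
  | null
  | read (x : Var)
  | write (x : Var) (v : Val)
  | fence
  | rmw (x : Var) (vexp vnew : Val)
  | internal (a : Intl)
  | ret (O : Op)

/-- Events: what takes place when an agent acts (`null` if the agent does not move).
A read action results in a read from the buffer (`rfb`) or a read from memory (`rfm`);
`prop x v` is an event of a dispatcher, and all non-null others are events of processes. -/
inductive Event (Var Val Op Intl : Type*) where
  | null
  | write (x : Var) (v : Val)
  | rfb (x : Var) (v : Val)
  | rfm (x : Var) (v : Val)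
  | fence
  | rmw (x : Var) (vexp vnew : Val)
  | internal (a : Intl)
  | ret (O : Op)
  | prop (x : Var) (v : Val)

/-- Entries of a local state. A read is recorded without its source (buffer or memory). -/
inductive Record (Var Val Op Intl : Type*) where
  | read (x : Var) (v : Val)
  | write (x : Var) (v : Val)
  | fence
  | rmw (x : Var) (vexp vnew : Val)
  | internal (a : Intl)
  | ret (O : Op)
  | invoke (O : Op)

/-- A local state is the history of a process, oldest record first. -/
abbrev LocalState (Var Val Op Intl : Type*) := List (Record Var Val Op Intl)

/-- A basic TSO state: main memory, and a FIFO store buffer (oldest item first) per process. -/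
structure MemState (n : ℕ) (Var Val : Type*) where
  mem : Var → Val
  buf : Fin n → List (Var × Val)

/-- A global state: a basic TSO state and a local state for every process. -/
structure GlobalState (n : ℕ) (Var Val Op Intl : Type*) where
  tso : MemState n Var Val
  loc : Fin n → LocalState Var Val Op Intl

/-- A (nondeterministic) protocol. -/
structure Protocol (n : ℕ) (Var Val Op Intl : Type*) where
  acts : Fin n → LocalState Var Val Op Intl → Set (Action Var Val Op Intl)
  nonempty : ∀ i l, (acts i l).Nonempty

namespace Event

variable {Var Val Op Intl : Type*}

/-- The process action of which the event is an outcome. -/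
def action : Event Var Val Op Intl → Option (Action Var Val Op Intl)
  | null => some .null
  | write x v => some (.write x v)
  | rfb x _ => some (.read x)
  | rfm x _ => some (.read x)
  | fence => some .fence
  | rmw x a b => some (.rmw x a b)
  | internal a => some (.internal a)
  | ret O => some (.ret O)
  | prop _ _ => none

/-- What the acting process adds to its local state. -/
def record : Event Var Val Op Intl → List (Record Var Val Op Intl)
  | null => []
  | write x v => [.write x v]
  | rfb x v => [.read x v]
  | rfm x v => [.read x v]
  | fence => [.fence]
  | rmw x a b => [.rmw x a b]
  | internal a => [.internal a]
  | ret O => [.ret O]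
  | prop _ _ => []

/-- The variable of which the event is a memory access, if it is one. -/
def memVar : Event Var Val Op Intl → Option Var
  | rfm x _ => some x
  | rmw x _ _ => some x
  | prop x _ => some x
  | _ => none

def isRfM : Event Var Val Op Intl → Bool
  | rfm _ _ => true
  | _ => false

def isRfB : Event Var Val Op Intl → Bool
  | rfb _ _ => true
  | _ => false

def isWrite : Event Var Val Op Intl → Bool
  | write _ _ => true
  | _ => false

def isProp : Event Var Val Op Intl → Bool
  | prop _ _ => true
  | _ => false

def isFenceOrRMW : Event Var Val Op Intl → Bool
  | fence => true
  | rmw _ _ _ => true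
  | _ => false

end Event

section Semantics

variable {n : ℕ} {Var Val Op Intl : Type*} [DecidableEq Var]

/-- The items of a store buffer that concern the variable `x`. -/
def restrict (β : List (Var × Val)) (x : Var) : List (Var × Val) :=
  β.filter fun p => p.1 = x

/-- The precondition of an event of an agent in a basic TSO state. -/
def Enabled (σ : MemState n Var Val) : Agent n → Event Var Val Op Intl → Prop
  | .proc _, .null => True
  | .proc _, .write _ _ => True
  | .proc i, .rfb x v => (restrict (σ.buf i) x).getLast? = some (x, v)
  | .proc i, .rfm x v => restrict (σ.buf i) x = [] ∧ σ.mem x = v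
  | .proc i, .fence => σ.buf i = []
  | .proc i, .rmw x vexp _ => σ.buf i = [] ∧ σ.mem x = vexp
  | .proc _, .internal _ => True
  | .proc _, .ret _ => True
  | .proc _, .prop _ _ => False
  | .disp _, .null => True
  | .disp i, .prop x v => (σ.buf i).head? = some (x, v)
  | .disp _, _ => False

/-- The effect of an event of an agent on a basic TSO state. -/
def effect (σ : MemState n Var Val) : Agent n → Event Var Val Op Intl → MemState n Var Val
  | .proc i, .write x v => { σ with buf := Function.update σ.buf i (σ.buf i ++ [(x, v)]) }
  | .proc _, .rmw x _ vnew => { σ with mem := Function.update σ.mem x vnew }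
  | .disp i, .prop x v =>
      { mem := Function.update σ.mem x v, buf := Function.update σ.buf i (σ.buf i).tail }
  | _, _ => σ

/-- The agents in the order in which a joint action is carried out: `1, …, n, d_1, …, d_n`. -/
def agentList (n : ℕ) : List (Agent n) :=
  (List.finRange n).map Agent.proc ++ (List.finRange n).map Agent.disp

/-- The effect of a joint action on a basic TSO state: its events one by one, in order. -/
def jointEffect (σ : MemState n Var Val) (e : Agent n → Event Var Val Op Intl) :
    MemState n Var Val :=
  (agentList n).foldl (fun σ' b => effect σ' b (e b)) σ

/-- Conflicting events `e` at agent `b` and `e'` at agent `b'`. -/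
def Conflicting (b : Agent n) (e : Event Var Val Op Intl) (b' : Agent n)
    (e' : Event Var Val Op Intl) : Prop :=
  ¬ (e.isRfM ∧ e'.isRfM) ∧
  (∃ x, e.memVar = some x ∧ e'.memVar = some x) ∧
  ¬ (∃ i, (b = .disp i ∧ e.isProp ∧ b' = .proc i ∧ e'.isRfM) ∨
          (b' = .disp i ∧ e'.isProp ∧ b = .proc i ∧ e.isRfM))

end Semantics

/-- The data of a run: the global state at time `t`, the events of the agents at time `t`
(that is, in round `t + 1`, which leads from time `t` to time `t + 1`), and the invocations that
the environment issues at time `t`. See `Run.IsRunOf` for the laws. -/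
structure Run (n : ℕ) (Var Val Op Intl : Type*) where
  state : ℕ → GlobalState n Var Val Op Intl
  ev : ℕ → Agent n → Event Var Val Op Intl
  inv : ℕ → Fin n → Option Op

namespace Run

variable {n : ℕ} {Var Val Op Intl : Type*}

/-- `r` is a TSO run of the protocol `P`. -/
structure IsRunOf [DecidableEq Var] (r : Run n Var Val Op Intl) (P : Protocol n Var Val Op Intl) :
    Prop where
  init_buf : ∀ i, (r.state 0).tso.buf i = []
  init_loc : ∀ i, (r.state 0).loc i = []
  enabled : ∀ t b, Enabled (r.state t).tso b (r.ev t b)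
  no_conflict : ∀ t b b', b ≠ b' → ¬ Conflicting b (r.ev t b) b' (r.ev t b')
  step_tso : ∀ t, (r.state (t + 1)).tso = jointEffect (r.state t).tso (r.ev t)
  step_loc : ∀ t i, (r.state (t + 1)).loc i =
    (r.state t).loc i ++ (r.ev t (.proc i)).record ++ ((r.inv t i).map Record.invoke).toList
  follows : ∀ t i, r.ev t (.proc i) ≠ .null →
    ∃ a ∈ P.acts i ((r.state t).loc i), (r.ev t (.proc i)).action = some a
  /-- After an invocation, the environment issues no other one to the same process before
  the process has performed a matching return. -/
  one_pending : ∀ i O t t', t < t' → r.inv t i = some O → r.inv t' i ≠ none →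
    ∃ τ, t < τ ∧ τ ≤ t' ∧ r.ev τ (.proc i) = .ret O

/-- The number of writes by process `i` before time `t`. -/
def numWrites (r : Run n Var Val Op Intl) (i : Fin n) (t : ℕ) : ℕ :=
  Nat.count (fun s => (r.ev s (.proc i)).isWrite = true) t

/-- The number of propagations by dispatcher `d_i` before time `t`. -/
def numProps (r : Run n Var Val Op Intl) (i : Fin n) (t : ℕ) : ℕ :=
  Nat.count (fun s => (r.ev s (.disp i)).isProp = true) t

/-- `r.HasTag b t (i, k)`: the event at node `⟨b, t⟩` writes, propagates or reads from the buffer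
the item that is created by the write number `k` (counted from `0`) of process `i`. Buffers are
queues, so the item at position `p` of the buffer of `i` at time `t` is the one created by the write
number `r.numProps i t + p`. -/
inductive HasTag (r : Run n Var Val Op Intl) : Agent n → ℕ → Fin n × ℕ → Prop
  | write (i : Fin n) (t : ℕ) (x : Var) (v : Val) (h : r.ev t (.proc i) = .write x v) :
      HasTag r (.proc i) t (i, r.numWrites i t)
  | rfb (i : Fin n) (t : ℕ) (x : Var) (v : Val) (β₁ β₂ : List (Var × Val))
      (h : r.ev t (.proc i) = .rfb x v) (hβ : (r.state t).tso.buf i = β₁ ++ (x, v) :: β₂)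
      (hlast : ∀ p ∈ β₂, p.1 ≠ x) :
      HasTag r (.proc i) t (i, r.numProps i t + β₁.length)
  | prop (i : Fin n) (t : ℕ) (x : Var) (v : Val) (h : r.ev t (.disp i) = .prop x v) :
      HasTag r (.disp i) t (i, r.numProps i t)

/-- The occurs-before relation between nodes `⟨b, t⟩` of a run. -/
inductive OccursBefore (r : Run n Var Val Op Intl) : Agent n × ℕ → Agent n × ℕ → Prop
  | locality (b : Agent n) (t t' : ℕ) (ht : t < t') : OccursBefore r (b, t) (b, t')
  | buffer (i : Fin n) (t t' : ℕ) (κ : Fin n × ℕ) (ht : t < t')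
      (h : (r.ev t (.proc i)).isWrite ∨ (r.ev t (.proc i)).isRfB)
      (h' : (r.ev t' (.disp i)).isProp)
      (hκ : r.HasTag (.proc i) t κ) (hκ' : r.HasTag (.disp i) t' κ) :
      OccursBefore r (.proc i, t) (.disp i, t')
  | memory (b c : Agent n) (t t' : ℕ) (x : Var) (ht : t < t')
      (h : (r.ev t b).memVar = some x) (h' : (r.ev t' c).memVar = some x)
      (hreads : ¬ ((r.ev t b).isRfM ∧ (r.ev t' c).isRfM))
      (hown : ¬ ∃ i, b = .disp i ∧ c = .proc i ∧ (r.ev t b).isProp ∧ (r.ev t' c).isRfM) :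
      OccursBefore r (b, t) (c, t')
  | fence (i : Fin n) (t t' : ℕ) (ht : t < t')
      (h : (r.ev t (.disp i)).isProp) (h' : (r.ev t' (.proc i)).isFenceOrRMW) :
      OccursBefore r (.disp i, t) (.proc i, t')
  | trans (θ₁ θ₂ θ₃ : Agent n × ℕ) (h : OccursBefore r θ₁ θ₂) (h' : OccursBefore r θ₂ θ₃) :
      OccursBefore r θ₁ θ₃

/-- No item is read from the buffer of a process in the round in which it is propagated. -/
def BufferReadsSeparate (r : Run n Var Val Op Intl) : Prop :=
  ∀ i t κ, (r.ev t (.proc i)).isRfB → r.HasTag (.proc i) t κ → ¬ r.HasTag (.disp i) t κ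

/-- There is a feedback loop between `⟨i, t₁⟩` and `⟨i, t₂⟩`. -/
def FeedbackLoop (r : Run n Var Val Op Intl) (i : Fin n) (t₁ t₂ : ℕ) : Prop :=
  ∃ b t, b ≠ .proc i ∧ b ≠ .disp i ∧
    r.OccursBefore (.proc i, t₁) (b, t) ∧ r.OccursBefore (b, t) (.proc i, t₂)

/-- Local equivalence: every process goes through the same local states. -/
def LocallyEquivalent (r r' : Run n Var Val Op Intl) : Prop :=
  ∀ j l, (∃ t, (r.state t).loc j = l) ↔ ∃ t, (r'.state t).loc j = l

/-- Only process `i` and its dispatcher take actions between the times `s` and `e`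
(both included). -/
def SoloBetween (r : Run n Var Val Op Intl) (i : Fin n) (s e : ℕ) : Prop :=
  ∀ t, s ≤ t → t ≤ e → ∀ b, b ≠ .proc i → b ≠ .disp i → r.ev t b = .null

/-- Every nonempty buffer is eventually propagated from. -/
def PropFair (r : Run n Var Val Op Intl) : Prop :=
  ∀ i t, (r.state t).tso.buf i ≠ [] → ∃ t', t ≤ t' ∧ (r.ev t' (.disp i)).isProp

/-- At time `t`, process `i` has an enabled non-null action to perform according to `P`. -/
def CanMove [DecidableEq Var] (r : Run n Var Val Op Intl) (P : Protocol n Var Val Op Intl)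
    (i : Fin n) (t : ℕ) : Prop :=
  ∃ e : Event Var Val Op Intl, e ≠ .null ∧ Enabled (r.state t).tso (.proc i) e ∧
    ∃ a ∈ P.acts i ((r.state t).loc i), e.action = some a

/-- A process that has an enabled action from some time on eventually moves. -/
def ProcFair [DecidableEq Var] (r : Run n Var Val Op Intl) (P : Protocol n Var Val Op Intl) :
    Prop :=
  ∀ i t, (∀ t', t ≤ t' → r.CanMove P i t') → ∃ t', t ≤ t' ∧ r.ev t' (.proc i) ≠ .null

end Run

/-- An operation instance: the invocation number `index` (counted from `0`) issued to the process
`proc`, of the operation named `name`. -/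
structure Operation (n : ℕ) (Op : Type*) where
  proc : Fin n
  name : Op
  index : ℕ

/-- The operation `X` occurs between `X.s = ⟨X.proc, s⟩` and `X.e = ⟨X.proc, e⟩` in `r`: it is invoked
at time `s` (in round `s + 1`), and its matching return, the first one after the invocation, is
performed in round `e` (at time `e - 1`). -/
def Operation.OccursBetween {n : ℕ} {Var Val Op Intl : Type*} (X : Operation n Op)
    (r : Run n Var Val Op Intl) (s e : ℕ) : Prop :=
  r.inv s X.proc = some X.name ∧
  Nat.count (fun t => (r.inv t X.proc).isSome = true) s = X.index ∧
  ∃ τ, s < τ ∧ e = τ + 1 ∧ r.ev τ (.proc X.proc) = .ret X.name ∧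
    ∀ τ', s < τ' → τ' < τ → r.ev τ' (.proc X.proc) ≠ .ret X.name

end TSO

/-!
Rescheduling the nodes of a run while respecting the occurs-before relation changes no local state.
Conflicting accesses keep their order, so an access to memory finds the value it found before, and
a fence or an `RMW` still finds the buffer empty. Only the order of a `prop` of `dᵢ` and a later
`RfM` of `i` may be reversed; then the value that `i` read from memory is still in its buffer, and
`i` obtains it by an `RfB`, which leaves the same record.

To isolate an operation `X` of process `i`, first carry out the nodes up to the time of `X.e`, other
than `X.s`, that `X.s` does not precede; then those of the remaining nodes that precede `X.e`; and
then all others. A node of the middle phase is `X.s` or lies between `X.s` and `X.e`, so without a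
feedback loop it belongs to `i` or `dᵢ`. All nodes after the time of `X.e` are delayed by the same
amount, so fairness is inherited.
-/

namespace TSO

attribute [ext] MemState GlobalState

section Count

variable {p : ℕ → Prop} [DecidablePred p] {k m : ℕ}

theorem exists_count_eq_of_lt_count (h : k < Nat.count p m) : ∃ s < m, p s ∧ Nat.count p s = k :=
  have hk : ∀ hf : (Set.ofPred p).Finite, k < hf.toFinset.card := fun hf =>
    h.trans_le (Nat.count_le_card hf m)
  ⟨Nat.nth p k, Nat.nth_lt_of_lt_count h, Nat.nth_mem k hk, Nat.count_nth hk⟩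

theorem count_le_of_forall_count_lt (h : ∀ s < m, p s → Nat.count p s < k) :
    Nat.count p m ≤ k := by
  by_contra! hlt
  obtain ⟨s, hs, hps, hk⟩ := exists_count_eq_of_lt_count hlt
  exact (h s hs hps).ne hk

end Count

section Restrict

variable {Var Val : Type*} [DecidableEq Var] {β : List (Var × Val)} {x : Var}

theorem restrict_eq_nil_iff : restrict β x = [] ↔ ∀ p ∈ β, p.1 ≠ x := by
  simp [restrict, List.filter_eq_nil_iff]

theorem getLast?_restrict_eq_some_iff {v : Val} :
    (restrict β x).getLast? = some (x, v) ↔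
      ∃ β₁ β₂, β = β₁ ++ (x, v) :: β₂ ∧ ∀ p ∈ β₂, p.1 ≠ x := by
  constructor
  · intro h
    obtain ⟨l, hl⟩ := List.getLast?_eq_some_iff.1 h
    obtain ⟨β₁, β', rfl, -, hβ'⟩ := List.filter_eq_append_iff.1 hl
    obtain ⟨γ, β₂, rfl, -, -, hβ₂⟩ := List.filter_eq_cons_iff.1 hβ'
    exact ⟨β₁ ++ γ, β₂, by simp, restrict_eq_nil_iff.1 hβ₂⟩
  · rintro ⟨β₁, β₂, rfl, hβ₂⟩
    have h : β₂.filter (fun p => p.1 = x) = [] := restrict_eq_nil_iff.2 hβ₂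
    simp [restrict, List.filter_append, h]

theorem exists_getLast?_restrict_eq_some (h : restrict β x ≠ []) :
    ∃ v, (restrict β x).getLast? = some (x, v) := by
  obtain ⟨⟨y, v⟩, hlast⟩ := Option.ne_none_iff_exists'.1 (mt List.getLast?_eq_none_iff.1 h)
  obtain rfl : y = x := by
    simpa [restrict] using List.of_mem_filter (List.mem_of_getLast? hlast)
  exact ⟨v, hlast⟩

end Restrict

namespace Event

variable {Var Val Op Intl : Type*} {e : Event Var Val Op Intl}

theorem isWrite_iff : e.isWrite = true ↔ ∃ x v, e = .write x v := by
  cases e <;> simp [isWrite]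

theorem isRfB_iff : e.isRfB = true ↔ ∃ x v, e = .rfb x v := by
  cases e <;> simp [isRfB]

theorem isProp_iff : e.isProp = true ↔ ∃ x v, e = .prop x v := by
  cases e <;> simp [isProp]

/-- The item that a process performing the event appends to its buffer, as a list of length at most
one. -/
def written : Event Var Val Op Intl → List (Var × Val)
  | write x v => [(x, v)]
  | _ => []

theorem length_written (e : Event Var Val Op Intl) :
    e.written.length = if e.isWrite = true then 1 else 0 := by
  cases e <;> simp [written, isWrite]

end Event

section Semantics

variable {n : ℕ} {Var Val Op Intl : Type*} [DecidableEq Var]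

/-- The value that an event of the agent stores in the variable `x` of the main memory, if any. -/
def storedVal (x : Var) : Agent n → Event Var Val Op Intl → Option Val
  | .proc _, .rmw y _ w => if y = x then some w else none
  | .disp _, .prop y w => if y = x then some w else none
  | _, _ => none

section StoredVal

variable {x : Var} {v : Val} {i : Fin n} {b c : Agent n} {e e' : Event Var Val Op Intl}

theorem storedVal_proc_eq_some : storedVal x (.proc i) e = some v ↔ ∃ a, e = .rmw x a v := by
  cases e <;> simp [storedVal]

theorem storedVal_disp_eq_some : storedVal x (.disp i) e = some v ↔ e = .prop x v := by
  cases e <;> simp [storedVal]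

theorem memVar_of_storedVal (h : storedVal x b e = some v) : e.memVar = some x := by
  cases b with
  | proc i => obtain ⟨a, rfl⟩ := storedVal_proc_eq_some.1 h; rfl
  | disp i => obtain rfl := storedVal_disp_eq_some.1 h; rfl

theorem isRfM_of_storedVal (h : storedVal x b e = some v) : e.isRfM = false := by
  cases b with
  | proc i => obtain ⟨a, rfl⟩ := storedVal_proc_eq_some.1 h; rfl
  | disp i => obtain rfl := storedVal_disp_eq_some.1 h; rfl

theorem conflicting_of_storedVal {w : Val} (h : storedVal x b e = some v)
    (h' : storedVal x c e' = some w) : Conflicting b e c e' := by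
  refine ⟨?_, ⟨x, memVar_of_storedVal h, memVar_of_storedVal h'⟩, ?_⟩ <;>
    simp [isRfM_of_storedVal h, isRfM_of_storedVal h']

end StoredVal

theorem effect_mem (σ : MemState n Var Val) (b : Agent n) (e : Event Var Val Op Intl) (x : Var) :
    (effect σ b e).mem x = (storedVal x b e).getD (σ.mem x) := by
  cases b <;> cases e <;> simp only [effect, storedVal, Function.update_apply, Option.getD_none] <;>
    grind

theorem effect_proc_buf (σ : MemState n Var Val) (i j : Fin n) (e : Event Var Val Op Intl) :
    (effect σ (.proc j) e).buf i = if i = j then σ.buf i ++ e.written else σ.buf i := by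
  rcases eq_or_ne i j with rfl | h
  · cases e <;> simp [effect, Event.written]
  · cases e <;> simp [effect, h]

theorem effect_disp_buf (σ : MemState n Var Val) (i j : Fin n) (e : Event Var Val Op Intl) :
    (effect σ (.disp j) e).buf i =
      if i = j ∧ e.isProp = true then (σ.buf i).tail else σ.buf i := by
  rcases eq_or_ne i j with rfl | h
  · cases e <;> simp [effect, Event.isProp]
  · cases e <;> simp [effect, h]

theorem foldl_effect_mem_eq {l : List (Agent n)} {σ : MemState n Var Val}
    {e : Agent n → Event Var Val Op Intl} {x : Var} {v : Val}
    (huniq : ∀ b ∈ l, ∀ w, storedVal x b (e b) = some w → w = v)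
    (hex : σ.mem x = v ∨ ∃ b ∈ l, storedVal x b (e b) = some v) :
    (l.foldl (fun σ' b => effect σ' b (e b)) σ).mem x = v := by
  induction l generalizing σ with
  | nil => simpa using hex
  | cons b l ih =>
    refine ih (fun c hc => huniq c (List.mem_cons_of_mem _ hc)) ?_
    rw [effect_mem]
    cases hb : storedVal x b (e b) with
    | some w => exact .inl (huniq b List.mem_cons_self w hb)
    | none => simpa [hb] using hex

theorem foldl_effect_proc_buf {l : List (Fin n)} (hl : l.Nodup) (σ : MemState n Var Val)
    (e : Agent n → Event Var Val Op Intl) (i : Fin n) :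
    ((l.map Agent.proc).foldl (fun σ' b => effect σ' b (e b)) σ).buf i =
      if i ∈ l then σ.buf i ++ (e (.proc i)).written else σ.buf i := by
  induction l generalizing σ with
  | nil => simp
  | cons j l ih =>
    obtain ⟨hj, hl⟩ := List.nodup_cons.1 hl
    rw [List.map_cons, List.foldl_cons, ih hl, effect_proc_buf]
    rcases eq_or_ne i j with rfl | h
    · simp [hj]
    · simp [h]

theorem foldl_effect_disp_buf {l : List (Fin n)} (hl : l.Nodup) (σ : MemState n Var Val)
    (e : Agent n → Event Var Val Op Intl) (i : Fin n) :
    ((l.map Agent.disp).foldl (fun σ' b => effect σ' b (e b)) σ).buf i =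
      if i ∈ l ∧ (e (.disp i)).isProp = true then (σ.buf i).tail else σ.buf i := by
  induction l generalizing σ with
  | nil => simp
  | cons j l ih =>
    obtain ⟨hj, hl⟩ := List.nodup_cons.1 hl
    rw [List.map_cons, List.foldl_cons, ih hl, effect_disp_buf]
    rcases eq_or_ne i j with rfl | h
    · simp [hj]
    · simp [h]

section JointEffect

variable {σ : MemState n Var Val} {e : Agent n → Event Var Val Op Intl} {x : Var}

theorem jointEffect_buf (σ : MemState n Var Val) (e : Agent n → Event Var Val Op Intl)
    (i : Fin n) :
    (jointEffect σ e).buf i =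
      if (e (.disp i)).isProp = true then (σ.buf i ++ (e (.proc i)).written).tail
      else σ.buf i ++ (e (.proc i)).written := by
  rw [jointEffect, agentList, List.foldl_append, foldl_effect_disp_buf (List.nodup_finRange n),
    foldl_effect_proc_buf (List.nodup_finRange n)]
  simp

theorem mem_agentList (b : Agent n) : b ∈ agentList n := by
  cases b <;> simp [agentList]

theorem jointEffect_mem_of_forall_eq_none (h : ∀ b, storedVal x b (e b) = none) :
    (jointEffect σ e).mem x = σ.mem x :=
  foldl_effect_mem_eq (fun b _ w hw => by simp [h b] at hw) (.inl rfl)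

theorem jointEffect_mem_of_storedVal {b : Agent n} {v : Val}
    (hconf : ∀ b c, b ≠ c → ¬ Conflicting b (e b) c (e c)) (hb : storedVal x b (e b) = some v) :
    (jointEffect σ e).mem x = v := by
  refine foldl_effect_mem_eq (fun c _ w hw => ?_) (.inr ⟨b, mem_agentList b, hb⟩)
  obtain rfl : b = c := of_not_not fun h => hconf b c h (conflicting_of_storedVal hb hw)
  exact Option.some_injective _ (hw.symm.trans hb)

end JointEffect

/-- The event by which the agent realizes the action of `e` in the state `σ`: a read from memory
becomes a read from the buffer if the buffer has an item for the variable (store-to-load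
forwarding). -/
def forward (σ : MemState n Var Val) : Agent n → Event Var Val Op Intl → Event Var Val Op Intl
  | .proc i, .rfm x v => if (restrict (σ.buf i) x).isEmpty then .rfm x v else .rfb x v
  | _, e => e

section Forward

variable {σ : MemState n Var Val} {b : Agent n} {e : Event Var Val Op Intl}

theorem forward_rfm_of_eq_nil {i : Fin n} {x : Var} {v : Val} (h : restrict (σ.buf i) x = []) :
    forward σ (.proc i) (.rfm x v : Event Var Val Op Intl) = .rfm x v := by
  simp [forward, h]

theorem forward_rfm_of_ne_nil {i : Fin n} {x : Var} {v : Val} (h : restrict (σ.buf i) x ≠ []) :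
    forward σ (.proc i) (.rfm x v : Event Var Val Op Intl) = .rfb x v := by
  simp [forward, h]

theorem forward_disp (i : Fin n) : forward σ (.disp i) e = e := rfl

theorem forward_of_memVar {x : Var} (h : (forward σ b e).memVar = some x) :
    forward σ b e = e := by
  unfold forward at h ⊢
  split at h
  · split_ifs at h ⊢
    · rfl
    · cases h
  · rfl

theorem forward_proc_of_enabled {σ' : MemState n Var Val} {i : Fin n} (hbuf : σ.buf i = σ'.buf i)
    (h : Enabled σ' (.proc i) e) : forward σ (.proc i) e = e := by
  cases e <;> first | rfl | exact forward_rfm_of_eq_nil (hbuf ▸ h.1)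

theorem record_forward : (forward σ b e).record = e.record := by
  unfold forward
  split
  · split_ifs <;> rfl
  · rfl

theorem action_forward : (forward σ b e).action = e.action := by
  unfold forward
  split
  · split_ifs <;> rfl
  · rfl

theorem written_forward : (forward σ b e).written = e.written := by
  unfold forward
  split
  · split_ifs <;> rfl
  · rfl

theorem forward_eq_null_iff : forward σ b e = .null ↔ e = .null := by
  unfold forward
  split
  · split_ifs <;> simp
  · rfl

theorem forward_eq_ret_iff {O : Op} : forward σ b e = .ret O ↔ e = .ret O := by
  unfold forward
  split
  · split_ifs <;> simp
  · rfl

theorem storedVal_forward (x : Var) : storedVal x b (forward σ b e) = storedVal x b e := by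
  unfold forward
  split
  · split_ifs <;> rfl
  · rfl

end Forward

end Semantics

namespace Run

variable {n : ℕ} {Var Val Op Intl : Type*} {r : Run n Var Val Op Intl} {i : Fin n} {t t' k : ℕ}

/-- The items that process `i` writes before time `t`, oldest first. -/
def writes (r : Run n Var Val Op Intl) (i : Fin n) (t : ℕ) : List (Var × Val) :=
  (List.range t).flatMap fun s => (r.ev s (.proc i)).written

theorem writes_succ (r : Run n Var Val Op Intl) (i : Fin n) (t : ℕ) :
    r.writes i (t + 1) = r.writes i t ++ (r.ev t (.proc i)).written := by
  simp [writes, List.range_succ]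

theorem length_writes (r : Run n Var Val Op Intl) (i : Fin n) (t : ℕ) :
    (r.writes i t).length = r.numWrites i t := by
  induction t with
  | zero => simp [writes, numWrites]
  | succ t ih =>
    rw [writes_succ, List.length_append, ih, numWrites, numWrites, Nat.count_succ,
      Event.length_written]

theorem writes_prefix (r : Run n Var Val Op Intl) (i : Fin n) (h : t ≤ t') :
    r.writes i t <+: r.writes i t' := by
  induction t', h using Nat.le_induction with
  | base => exact List.prefix_rfl
  | succ m _ ih => exact ih.trans ⟨_, (r.writes_succ i m).symm⟩

theorem writes_getElem?_of_lt {p : Var × Val} (h : (r.writes i t)[k]? = some p)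
    (hk : k < r.numWrites i t') : (r.writes i t')[k]? = some p := by
  rw [← length_writes] at hk
  rcases le_total t t' with htt | htt <;> obtain ⟨l, hl⟩ := r.writes_prefix i htt
  · rw [← hl, List.getElem?_append_left (List.getElem?_eq_some_iff.1 h).1, h]
  · rwa [← hl, List.getElem?_append_left hk] at h

theorem numWrites_mono (r : Run n Var Val Op Intl) (i : Fin n) : Monotone (r.numWrites i) :=
  Nat.count_monotone _

theorem numProps_mono (r : Run n Var Val Op Intl) (i : Fin n) : Monotone (r.numProps i) :=
  Nat.count_monotone _

theorem numProps_lt (h : (r.ev t (.disp i)).isProp = true) (ht : t < t') :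
    r.numProps i t < r.numProps i t' :=
  Nat.count_strict_mono h ht

theorem numProps_succ (r : Run n Var Val Op Intl) (i : Fin n) (t : ℕ) :
    r.numProps i (t + 1) = r.numProps i t + if (r.ev t (.disp i)).isProp = true then 1 else 0 :=
  Nat.count_succ _ _

theorem numWrites_succ (r : Run n Var Val Op Intl) (i : Fin n) (t : ℕ) :
    r.numWrites i (t + 1) = r.numWrites i t + (r.ev t (.proc i)).written.length := by
  rw [← length_writes, ← length_writes, writes_succ, List.length_append]

theorem hasTag_disp_iff {κ : Fin n × ℕ} :
    r.HasTag (.disp i) t κ ↔ (r.ev t (.disp i)).isProp = true ∧ κ = (i, r.numProps i t) := by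
  constructor
  · intro h
    cases h with
    | prop _ _ x v he => exact ⟨Event.isProp_iff.2 ⟨x, v, he⟩, rfl⟩
  · rintro ⟨h, rfl⟩
    obtain ⟨x, v, h⟩ := Event.isProp_iff.1 h
    exact .prop i t x v h

theorem bufferReadsSeparate_iff :
    r.BufferReadsSeparate ↔ ∀ i t x v β, r.ev t (.proc i) = .rfb x v →
      (r.ev t (.disp i)).isProp = true → (r.state t).tso.buf i = (x, v) :: β →
        ∃ p ∈ β, p.1 = x := by
  constructor
  · intro hsep i t x v β he hp hβ
    by_contra! hlast
    exact hsep i t _ (Event.isRfB_iff.2 ⟨x, v, he⟩) (.rfb i t x v [] β he hβ hlast)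
      (hasTag_disp_iff.2 ⟨hp, rfl⟩)
  · intro hsep i t κ hrfb hread hprop
    obtain ⟨hp, rfl⟩ := hasTag_disp_iff.1 hprop
    obtain ⟨x, v, he⟩ := Event.isRfB_iff.1 hrfb
    generalize hκ : (i, r.numProps i t) = κ at hread
    cases hread with
    | write _ _ y w h => cases he.symm.trans h
    | rfb _ _ y w β₁ β₂ h hβ hlast =>
      obtain rfl : β₁ = [] := by simpa using hκ
      obtain ⟨p, hpβ, hpx⟩ := hsep i t y w β₂ h hp hβ
      exact hlast p hpβ hpx

section Buffer

variable [DecidableEq Var]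

theorem buf_eq_drop_writes (h0 : (r.state 0).tso.buf i = [])
    (hstep : ∀ t, (r.state (t + 1)).tso = jointEffect (r.state t).tso (r.ev t))
    (hle : ∀ t, r.numProps i t ≤ r.numWrites i t) (t : ℕ) :
    (r.state t).tso.buf i = (r.writes i t).drop (r.numProps i t) := by
  induction t with
  | zero => simp [h0, writes]
  | succ t ih =>
    have hlen : r.numProps i t ≤ (r.writes i t).length := r.length_writes i t ▸ hle t
    rw [hstep, jointEffect_buf, ih, writes_succ, numProps_succ,
      ← List.drop_append_of_le_length hlen, List.tail_drop]
    split_ifs <;> rfl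

variable {P : Protocol n Var Val Op Intl} {x : Var} {v : Val}

theorem IsRunOf.numProps_add_length_buf (hr : r.IsRunOf P) (i : Fin n) (t : ℕ) :
    r.numProps i t + ((r.state t).tso.buf i).length = r.numWrites i t := by
  induction t with
  | zero => simp [hr.init_buf, numProps, numWrites]
  | succ t ih =>
    rw [hr.step_tso, jointEffect_buf, numProps_succ, numWrites_succ, ← ih]
    split_ifs with hp
    · obtain ⟨x, v, he⟩ := Event.isProp_iff.1 hp
      have hhead : ((r.state t).tso.buf i).head? = some (x, v) := by
        simpa only [he, Enabled] using hr.enabled t (.disp i)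
      obtain ⟨β, hβ⟩ := List.head?_eq_some_iff.1 hhead
      rw [hβ, List.cons_append, List.tail_cons, List.length_append, List.length_cons]
      omega
    · simp [add_assoc]

theorem IsRunOf.numProps_le_numWrites (hr : r.IsRunOf P) (i : Fin n) (t : ℕ) :
    r.numProps i t ≤ r.numWrites i t :=
  (Nat.le_add_right _ _).trans_eq (hr.numProps_add_length_buf i t)

theorem IsRunOf.buf_eq (hr : r.IsRunOf P) (i : Fin n) (t : ℕ) :
    (r.state t).tso.buf i = (r.writes i t).drop (r.numProps i t) :=
  buf_eq_drop_writes (hr.init_buf i) hr.step_tso (hr.numProps_le_numWrites i) t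

theorem IsRunOf.writes_getElem?_of_prop (hr : r.IsRunOf P) (h : r.ev t (.disp i) = .prop x v) :
    (r.writes i t)[r.numProps i t]? = some (x, v) := by
  have hen := hr.enabled t (.disp i)
  rwa [h, Enabled, hr.buf_eq, List.head?_drop] at hen

theorem IsRunOf.buf_ne_nil_of_forall_not_isProp (hr : r.IsRunOf P) (htt : t ≤ t')
    (hne : (r.state t).tso.buf i ≠ [])
    (hno : ∀ u, t ≤ u → u < t' → (r.ev u (.disp i)).isProp = false) :
    (r.state t').tso.buf i ≠ [] := by
  induction t', htt using Nat.le_induction with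
  | base => exact hne
  | succ m hm ih =>
    rw [hr.step_tso, jointEffect_buf, hno m hm m.lt_succ_self]
    exact List.append_ne_nil_of_left_ne_nil (ih fun u h₁ h₂ => hno u h₁ (h₂.trans m.lt_succ_self)) _

end Buffer

theorem OccursBefore.time_lt {θ θ' : Agent n × ℕ} (h : r.OccursBefore θ θ') : θ.2 < θ'.2 := by
  induction h with
  | trans _ _ _ _ _ h₁ h₂ => exact h₁.trans h₂
  | _ => assumption

section Stores

variable [DecidableEq Var]

/-- The event at the node `⟨b, t⟩` stores a value in the variable `x` of the main memory. -/
def Stores (r : Run n Var Val Op Intl) (x : Var) (b : Agent n) (t : ℕ) : Prop :=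
  ∃ v, storedVal x b (r.ev t b) = some v

variable {P : Protocol n Var Val Op Intl} {x : Var} {v w : Val} {b c : Agent n}

theorem stores_disp_iff : r.Stores x (.disp i) t ↔ ∃ v, r.ev t (.disp i) = .prop x v :=
  exists_congr fun _ => storedVal_disp_eq_some

theorem stores_rmw (h : r.ev t (.proc i) = .rmw x v w) : r.Stores x (.proc i) t :=
  ⟨w, storedVal_proc_eq_some.2 ⟨v, h⟩⟩

theorem Stores.memVar (h : r.Stores x b t) : (r.ev t b).memVar = some x :=
  memVar_of_storedVal h.choose_spec

theorem Stores.isRfM (h : r.Stores x b t) : (r.ev t b).isRfM = false :=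
  isRfM_of_storedVal h.choose_spec

theorem Stores.agent_unique (hr : r.IsRunOf P) (hb : r.Stores x b t) (hc : r.Stores x c t) :
    b = c :=
  of_not_not fun h =>
    hr.no_conflict t b c h (conflicting_of_storedVal hb.choose_spec hc.choose_spec)

theorem IsRunOf.mem_succ_of_storedVal (hr : r.IsRunOf P)
    (h : storedVal x b (r.ev t b) = some v) : (r.state (t + 1)).tso.mem x = v := by
  rw [hr.step_tso]
  exact jointEffect_mem_of_storedVal (hr.no_conflict t) h

theorem IsRunOf.mem_eq_of_forall_not_stores (hr : r.IsRunOf P) (htt : t ≤ t')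
    (h : ∀ u, t ≤ u → u < t' → ∀ b, ¬ r.Stores x b u) :
    (r.state t').tso.mem x = (r.state t).tso.mem x := by
  induction t', htt using Nat.le_induction with
  | base => rfl
  | succ m hm ih =>
    rw [hr.step_tso, jointEffect_mem_of_forall_eq_none fun b =>
      Option.eq_none_iff_forall_ne_some.2 fun v hv => h m hm m.lt_succ_self b ⟨v, hv⟩]
    exact ih fun u h₁ h₂ => h u h₁ (h₂.trans m.lt_succ_self)

theorem Stores.occursBefore (h : r.Stores x b t) (h' : r.Stores x c t') (htt : t < t') :
    r.OccursBefore (b, t) (c, t') :=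
  .memory b c t t' x htt h.memVar h'.memVar (by simp [h.isRfM]) (by simp [h'.isRfM])

theorem Stores.occursBefore_rfm (h : r.Stores x b t) (hb : b ≠ .disp i)
    (he : r.ev t' (.proc i) = .rfm x v) (htt : t < t') : r.OccursBefore (b, t) (.proc i, t') := by
  refine .memory b _ t t' x htt h.memVar (by rw [he]; rfl) (by simp [h.isRfM]) ?_
  rintro ⟨j, rfl, hj, -⟩
  exact hb (congrArg Agent.disp (Agent.proc.inj hj).symm)

theorem Stores.rfm_occursBefore (h : r.Stores x b t') (he : r.ev t (.proc i) = .rfm x v)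
    (htt : t < t') : r.OccursBefore (.proc i, t) (b, t') :=
  .memory _ b t t' x htt (by rw [he]; rfl) h.memVar (by simp [h.isRfM]) (by simp)

theorem IsRunOf.not_stores_of_rfm (hr : r.IsRunOf P) (he : r.ev t (.proc i) = .rfm x v) :
    ¬ r.Stores x b t := by
  intro h
  have hne : b ≠ .proc i := by
    rintro rfl
    simpa [he, Event.isRfM] using h.isRfM
  have hen := hr.enabled t (.proc i)
  rw [he, Enabled] at hen
  refine hr.no_conflict t b (.proc i) hne
    ⟨by simp [h.isRfM], ⟨x, h.memVar, by rw [he]; rfl⟩, ?_⟩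
  rintro ⟨j, ⟨rfl, -, hj, -⟩ | ⟨hj, -⟩⟩
  · obtain rfl := Agent.proc.inj hj
    obtain ⟨w, hw⟩ := stores_disp_iff.1 h
    have hen' := hr.enabled t (.disp i)
    rw [hw, Enabled] at hen'
    exact restrict_eq_nil_iff.1 hen.1 _ (List.mem_of_head? hen') rfl
  · cases hj

end Stores

section Propagation

variable [DecidableEq Var] {P : Protocol n Var Val Op Intl} {x : Var} {w : Val}

theorem IsRunOf.exists_write_occursBefore (hr : r.IsRunOf P)
    (h : (r.ev t (.disp i)).isProp = true) :
    ∃ t₀, r.OccursBefore (.proc i, t₀) (.disp i, t) ∧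
      r.numProps i t < r.numWrites i (t₀ + 1) := by
  obtain ⟨x, v, he⟩ := Event.isProp_iff.1 h
  have hlt := (List.getElem?_eq_some_iff.1 (hr.writes_getElem?_of_prop he)).1
  rw [length_writes] at hlt
  obtain ⟨t₀, ht₀, hwrite, hcount⟩ := exists_count_eq_of_lt_count hlt
  obtain ⟨y, w, hy⟩ := Event.isWrite_iff.1 hwrite
  have htag : r.HasTag (.proc i) t₀ (i, r.numProps i t) := hcount ▸ .write i t₀ y w hy
  refine ⟨t₀, .buffer i t₀ t _ ht₀ (.inl hwrite) h htag (.prop i t x v he), ?_⟩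
  rw [← hcount]
  exact Nat.count_strict_mono hwrite t₀.lt_succ_self

theorem IsRunOf.exists_last_prop (hr : r.IsRunOf P) {β₁ β₂ : List (Var × Val)}
    (hnil : restrict ((r.state t).tso.buf i) x = [])
    (hwrites : r.writes i t = β₁ ++ (x, w) :: β₂) (hβ₂ : ∀ p ∈ β₂, p.1 ≠ x) :
    ∃ u < t, r.ev u (.disp i) = .prop x w ∧ r.numProps i u = β₁.length ∧
      ∀ u', u < u' → u' < t → ¬ r.Stores x (.disp i) u' := by
  have hitem : (r.writes i t)[β₁.length]? = some (x, w) := by simp [hwrites]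
  have hlt : β₁.length < r.numProps i t := by
    by_contra! hle
    refine restrict_eq_nil_iff.1 hnil (x, w) ?_ rfl
    rw [hr.buf_eq, hwrites, List.drop_append_of_le_length hle]
    simp
  obtain ⟨u, hut, hprop, hcount⟩ := exists_count_eq_of_lt_count hlt
  change r.numProps i u = β₁.length at hcount
  have hle := hr.numProps_le_numWrites i t
  obtain ⟨y, v, he⟩ := Event.isProp_iff.1 hprop
  have hitem' := writes_getElem?_of_lt (hr.writes_getElem?_of_prop he) (hcount ▸ hlt.trans_le hle)
  rw [hcount, hitem] at hitem'
  obtain ⟨rfl, rfl⟩ : x = y ∧ w = v := by simpa using hitem'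
  refine ⟨u, hut, he, hcount, fun u' huu' hu't hstore => ?_⟩
  obtain ⟨v, hv⟩ := stores_disp_iff.1 hstore
  have hlt' : β₁.length < r.numProps i u' := hcount ▸ numProps_lt hprop huu'
  have hmem : (x, v) ∈ (r.writes i t).drop (β₁.length + 1) := by
    refine List.mem_of_getElem? (i := r.numProps i u' - (β₁.length + 1)) ?_
    rw [List.getElem?_drop, Nat.add_sub_cancel' hlt']
    exact writes_getElem?_of_lt (hr.writes_getElem?_of_prop hv)
      ((numProps_lt (Event.isProp_iff.2 ⟨x, v, hv⟩) hu't).trans_le hle)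
  rw [hwrites] at hmem
  exact hβ₂ _ (by simpa using hmem) rfl

end Propagation

end Run

/-- A rescheduling of the nodes of `r` that respects the occurs-before relation, and makes only such
nodes simultaneous that are simultaneous in `r`. The node `⟨b, t⟩` is moved to time `pos b t`. -/
structure Reordering {n : ℕ} {Var Val Op Intl : Type*} (r : Run n Var Val Op Intl) where
  pos : Agent n → ℕ → ℕ
  pos_lt_pos : ∀ {b t c t'}, r.OccursBefore (b, t) (c, t') → pos b t < pos c t'
  eq_of_pos_eq : ∀ {b t c t'}, pos b t = pos c t' → t = t'

namespace Reordering

variable {n : ℕ} {Var Val Op Intl : Type*} {r : Run n Var Val Op Intl} (ρ : Reordering r)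
  {b c : Agent n} {i : Fin n} {t u T : ℕ}

section LocalTime

theorem pos_strictMono (b : Agent n) : StrictMono (ρ.pos b) :=
  fun t t' h => ρ.pos_lt_pos (.locality b t t' h)

/-- Some node of the agent `b` is moved to time `T`. -/
def Active (b : Agent n) (T : ℕ) : Prop := ∃ t, ρ.pos b t = T

noncomputable instance (b : Agent n) : DecidablePred (ρ.Active b) := Classical.decPred _

/-- The number of nodes of the agent `b` that are moved to times before `T`: the time of `r` that
the agent has reached at time `T` of the new schedule. -/
noncomputable def localTime (b : Agent n) (T : ℕ) : ℕ := Nat.count (ρ.Active b) T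

theorem infinite_active (b : Agent n) : (Set.ofPred (ρ.Active b)).Infinite :=
  Set.infinite_range_of_injective (ρ.pos_strictMono b).injective

theorem pos_eq_nth (b : Agent n) (t : ℕ) : ρ.pos b t = Nat.nth (ρ.Active b) t := by
  have hlt : ∀ t, ∀ hf : (Set.ofPred (ρ.Active b)).Finite, t < hf.toFinset.card :=
    fun _ hf => (ρ.infinite_active b hf).elim
  refine Nat.eq_nth_of_strictMonoOn_of_mapsTo_of_surjOn (ρ.pos b) ?_
    (fun t _ => Set.mem_range_self t) ((ρ.pos_strictMono b).strictMonoOn _) (hlt t)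
  rintro _ ⟨t, rfl⟩
  exact ⟨t, hlt t, rfl⟩

theorem lt_localTime : t < ρ.localTime b T ↔ ρ.pos b t < T := by
  rw [pos_eq_nth]
  exact Nat.lt_nth_iff_count_lt (ρ.infinite_active b)

theorem localTime_pos (b : Agent n) (t : ℕ) : ρ.localTime b (ρ.pos b t) = t := by
  rw [pos_eq_nth]
  exact Nat.count_nth_of_infinite (ρ.infinite_active b) t

theorem localTime_zero (b : Agent n) : ρ.localTime b 0 = 0 := Nat.count_zero _

theorem localTime_succ_pos (b : Agent n) (t : ℕ) : ρ.localTime b (ρ.pos b t + 1) = t + 1 := by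
  rw [pos_eq_nth]
  exact Nat.count_nth_succ_of_infinite (ρ.infinite_active b) t

theorem localTime_succ_of_not_active (h : ¬ ρ.Active b T) :
    ρ.localTime b (T + 1) = ρ.localTime b T :=
  Nat.count_succ_eq_count_iff.2 h

theorem count_eq {p q : ℕ → Prop} [DecidablePred p] [DecidablePred q]
    (h : ∀ T, q T ↔ ∃ t, ρ.pos b t = T ∧ p t) (T : ℕ) :
    Nat.count q T = Nat.count p (ρ.localTime b T) := by
  induction T with
  | zero => rw [localTime_zero, Nat.count_zero, Nat.count_zero]
  | succ T ih =>
    by_cases ha : ρ.Active b T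
    · obtain ⟨t, rfl⟩ := ha
      have hqp : q (ρ.pos b t) ↔ p t := by
        simp [h, (ρ.pos_strictMono b).injective.eq_iff]
      rw [Nat.count_succ, ih, localTime_pos, localTime_succ_pos, Nat.count_succ,
        if_congr hqp rfl rfl]
    · have hq : ¬ q T := fun hq => ha (((h T).1 hq).imp fun _ => And.left)
      rw [Nat.count_succ, ih, if_neg hq, add_zero, localTime_succ_of_not_active _ ha]

theorem numProps_localTime_le_of_hasTag (hsep : r.BufferReadsSeparate) {k : ℕ}
    (hrfb : (r.ev t (.proc i)).isRfB = true) (htag : r.HasTag (.proc i) t (i, k))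
    (hk : r.numProps i t ≤ k) :
    r.numProps i (ρ.localTime (.disp i) (ρ.pos (.proc i) t)) ≤ k := by
  by_contra! hlt
  obtain ⟨u, hu, hprop, hcount⟩ := exists_count_eq_of_lt_count hlt
  have htag' : r.HasTag (.disp i) u (i, k) := Run.hasTag_disp_iff.2 ⟨hprop, by rw [← hcount]; rfl⟩
  rcases lt_trichotomy u t with hut | rfl | htu
  · exact hk.not_gt (hcount ▸ Run.numProps_lt hprop hut)
  · exact hsep i u _ hrfb htag htag'
  · exact (ρ.pos_lt_pos (.buffer i t u _ htu (.inr hrfb) hprop htag htag')).not_gt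
      (ρ.lt_localTime.1 hu)

end LocalTime

section Run

variable [DecidableEq Var]

/-- The event of `r` that the agent `b` is to perform at time `T`. -/
noncomputable def scheduled (T : ℕ) (b : Agent n) : Event Var Val Op Intl :=
  if ρ.Active b T then r.ev (ρ.localTime b T) b else .null

/-- The basic TSO states that result from performing the scheduled events with store-to-load
forwarding. -/
noncomputable def tso : ℕ → MemState n Var Val
  | 0 => (r.state 0).tso
  | T + 1 => jointEffect (tso T) fun b => forward (tso T) b (ρ.scheduled T b)

/-- The run that results from rescheduling the nodes of `r`. An invocation in `r` is moved together
with the node of the invoked process. -/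
noncomputable def run : Run n Var Val Op Intl where
  state T := ⟨ρ.tso T, fun i => (r.state (ρ.localTime (.proc i) T)).loc i⟩
  ev T b := forward (ρ.tso T) b (ρ.scheduled T b)
  inv T i := if ρ.Active (.proc i) T then r.inv (ρ.localTime (.proc i) T) i else none

theorem run_ev_pos (b : Agent n) (t : ℕ) :
    ρ.run.ev (ρ.pos b t) b = forward (ρ.tso (ρ.pos b t)) b (r.ev t b) := by
  simp only [run, scheduled, Active, exists_apply_eq_apply, if_true, localTime_pos]

theorem run_ev_of_not_active (h : ¬ ρ.Active b T) : ρ.run.ev T b = .null := by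
  simp only [run, scheduled, h, if_false, forward_eq_null_iff]

theorem run_inv_pos (i : Fin n) (t : ℕ) : ρ.run.inv (ρ.pos (.proc i) t) i = r.inv t i := by
  simp only [run, Active, exists_apply_eq_apply, if_true, localTime_pos]

theorem run_inv_of_not_active (h : ¬ ρ.Active (.proc i) T) : ρ.run.inv T i = none := by
  simp only [run, h, if_false]

theorem active_of_run_ev_ne_null (h : ρ.run.ev T b ≠ .null) : ρ.Active b T :=
  of_not_not fun ha => h (ρ.run_ev_of_not_active ha)

theorem active_of_run_inv_ne_none (h : ρ.run.inv T i ≠ none) : ρ.Active (.proc i) T :=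
  of_not_not fun ha => h (ρ.run_inv_of_not_active ha)

theorem exists_pos_of_memVar {x : Var} (h : (ρ.run.ev T b).memVar = some x) :
    ∃ t, ρ.pos b t = T ∧ ρ.run.ev T b = r.ev t b := by
  obtain ⟨t, rfl⟩ := ρ.active_of_run_ev_ne_null (b := b) (T := T)
    fun hnull => by simp [hnull, Event.memVar] at h
  rw [run_ev_pos] at h ⊢
  exact ⟨t, rfl, forward_of_memVar h⟩

theorem run_disp_isProp_iff :
    (ρ.run.ev T (.disp i)).isProp = true ↔
      ∃ t, ρ.pos (.disp i) t = T ∧ (r.ev t (.disp i)).isProp = true := by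
  constructor
  · intro h
    obtain ⟨t, rfl⟩ := ρ.active_of_run_ev_ne_null (b := .disp i) (T := T)
      fun hnull => by simp [hnull, Event.isProp] at h
    exact ⟨t, rfl, by rwa [run_ev_pos, forward_disp] at h⟩
  · rintro ⟨t, rfl, h⟩
    rwa [run_ev_pos, forward_disp]

theorem storedVal_run_ev_eq_some_iff {x : Var} {v : Val} :
    storedVal x b (ρ.run.ev T b) = some v ↔
      ∃ t, ρ.pos b t = T ∧ storedVal x b (r.ev t b) = some v := by
  constructor
  · intro h
    obtain ⟨t, rfl, he⟩ := ρ.exists_pos_of_memVar (memVar_of_storedVal h)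
    exact ⟨t, rfl, he ▸ h⟩
  · rintro ⟨t, rfl, h⟩
    rwa [run_ev_pos, storedVal_forward]

theorem numProps_run (i : Fin n) (T : ℕ) :
    ρ.run.numProps i T = r.numProps i (ρ.localTime (.disp i) T) :=
  ρ.count_eq (fun _ => ρ.run_disp_isProp_iff) T

theorem writes_run (i : Fin n) (T : ℕ) :
    ρ.run.writes i T = r.writes i (ρ.localTime (.proc i) T) := by
  induction T with
  | zero => rw [localTime_zero, Run.writes, Run.writes, List.range_zero, List.flatMap_nil,
      List.flatMap_nil]
  | succ T ih =>
    rw [Run.writes_succ, ih]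
    by_cases ha : ρ.Active (.proc i) T
    · obtain ⟨t, rfl⟩ := ha
      rw [run_ev_pos, written_forward, localTime_pos, localTime_succ_pos, Run.writes_succ]
    · rw [run_ev_of_not_active _ ha, localTime_succ_of_not_active _ ha]
      exact List.append_nil _

theorem numWrites_run (i : Fin n) (T : ℕ) :
    ρ.run.numWrites i T = r.numWrites i (ρ.localTime (.proc i) T) := by
  rw [← Run.length_writes, writes_run, Run.length_writes]

variable {P : Protocol n Var Val Op Intl}

theorem run_no_conflict (hr : r.IsRunOf P) (T : ℕ) (hbc : b ≠ c) :
    ¬ Conflicting b (ρ.run.ev T b) c (ρ.run.ev T c) := by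
  intro hconf
  obtain ⟨x, hb, hc⟩ := hconf.2.1
  obtain ⟨t, rfl, heb⟩ := ρ.exists_pos_of_memVar hb
  obtain ⟨t', htt', hec⟩ := ρ.exists_pos_of_memVar hc
  obtain rfl := ρ.eq_of_pos_eq htt'
  rw [heb, hec] at hconf
  exact hr.no_conflict _ b c hbc hconf

theorem numProps_lt_numWrites_localTime (hr : r.IsRunOf P)
    (h : (r.ev t (.disp i)).isProp = true) (hT : ρ.pos (.disp i) t ≤ T) :
    r.numProps i t < r.numWrites i (ρ.localTime (.proc i) T) := by
  obtain ⟨t₀, hob, hlt⟩ := hr.exists_write_occursBefore h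
  exact hlt.trans_le (r.numWrites_mono i (ρ.lt_localTime.2 ((ρ.pos_lt_pos hob).trans_le hT)))

theorem numProps_localTime_le (hr : r.IsRunOf P) (i : Fin n) (T : ℕ) :
    r.numProps i (ρ.localTime (.disp i) T) ≤ r.numWrites i (ρ.localTime (.proc i) T) :=
  count_le_of_forall_count_lt fun _ ht hprop =>
    ρ.numProps_lt_numWrites_localTime hr hprop (ρ.lt_localTime.1 ht).le

theorem buf_tso (hr : r.IsRunOf P) (i : Fin n) (T : ℕ) :
    (ρ.tso T).buf i =
      (r.writes i (ρ.localTime (.proc i) T)).drop (r.numProps i (ρ.localTime (.disp i) T)) := by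
  rw [← writes_run, ← numProps_run]
  refine Run.buf_eq_drop_writes (r := ρ.run) (hr.init_buf i) (fun _ => rfl) (fun T => ?_) T
  rw [numProps_run, numWrites_run]
  exact ρ.numProps_localTime_le hr i T

/-- The stores to `x` that are scheduled before time `T` are those performed in `r` before time
`u`. -/
def IsCut (x : Var) (T u : ℕ) : Prop := ∀ b t, r.Stores x b t → (ρ.pos b t < T ↔ t < u)

variable {ρ} {x : Var}

theorem IsCut.mem_eq (hr : r.IsRunOf P) (h : ρ.IsCut x T u) :
    (ρ.tso T).mem x = (r.state u).tso.mem x := by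
  induction T generalizing u with
  | zero =>
    exact (hr.mem_eq_of_forall_not_stores u.zero_le fun t _ htu b hstore =>
      Nat.not_lt_zero _ ((h b t hstore).2 htu)).symm
  | succ T ih =>
    by_cases hex : ∃ b v, storedVal x b (ρ.run.ev T b) = some v
    · obtain ⟨b, v, hv⟩ := hex
      obtain ⟨t, rfl, hv'⟩ := ρ.storedVal_run_ev_eq_some_iff.1 hv
      have htu : t < u := (h b t ⟨v, hv'⟩).1 (Nat.lt_succ_self _)
      have hlast : ∀ t', t + 1 ≤ t' → t' < u → ∀ c, ¬ r.Stores x c t' := fun t' htt' ht'u c hc =>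
        (Nat.lt_succ_iff.1 ((h c t' hc).2 ht'u)).not_gt
          (ρ.pos_lt_pos (Run.Stores.occursBefore ⟨v, hv'⟩ hc htt'))
      calc (ρ.tso (ρ.pos b t + 1)).mem x
          = v := jointEffect_mem_of_storedVal (fun _ _ hne => ρ.run_no_conflict hr _ hne) hv
        _ = (r.state (t + 1)).tso.mem x := (hr.mem_succ_of_storedVal hv').symm
        _ = (r.state u).tso.mem x := (hr.mem_eq_of_forall_not_stores htu hlast).symm
    · push Not at hex
      have hcut : ρ.IsCut x T u := fun b t ⟨v, hv⟩ => by
        have hne : ρ.pos b t ≠ T := fun hT =>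
          hex b v (ρ.storedVal_run_ev_eq_some_iff.2 ⟨t, hT, hv⟩)
        rw [← h b t ⟨v, hv⟩, Nat.lt_succ_iff, hne.le_iff_lt]
      rw [← ih hcut]
      exact jointEffect_mem_of_forall_eq_none fun b =>
        Option.eq_none_iff_forall_ne_some.2 (hex b)

theorem isCut_of_stores (hr : r.IsRunOf P) (h : r.Stores x b t) : ρ.IsCut x (ρ.pos b t) t := by
  intro c u hc
  rcases lt_trichotomy u t with hlt | rfl | hlt
  · exact iff_of_true (ρ.pos_lt_pos (hc.occursBefore h hlt)) hlt
  · obtain rfl := hc.agent_unique hr h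
    exact iff_of_false (lt_irrefl _) (lt_irrefl _)
  · exact iff_of_false (ρ.pos_lt_pos (h.occursBefore hc hlt)).not_gt hlt.not_gt

theorem pos_lt_of_restrict_eq_nil (hr : r.IsRunOf P) (h : r.Stores x (.disp i) u)
    (htu : u < t) (hnil : restrict ((ρ.tso (ρ.pos (.proc i) t)).buf i) x = []) :
    ρ.pos (.disp i) u < ρ.pos (.proc i) t := by
  obtain ⟨w, he⟩ := Run.stores_disp_iff.1 h
  by_contra! hle
  have hle' : ρ.localTime (.disp i) (ρ.pos (.proc i) t) ≤ u :=
    not_lt.1 (mt ρ.lt_localTime.1 hle.not_gt)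
  have hlt : r.numProps i u < r.numWrites i t :=
    (Run.numProps_lt (by rw [he]; rfl) htu).trans_le (hr.numProps_le_numWrites i t)
  refine restrict_eq_nil_iff.1 hnil (x, w) (List.mem_of_getElem?
    (i := r.numProps i u - r.numProps i (ρ.localTime (.disp i) (ρ.pos (.proc i) t))) ?_) rfl
  rw [buf_tso _ hr, localTime_pos, List.getElem?_drop,
    Nat.add_sub_cancel' (r.numProps_mono i hle')]
  exact Run.writes_getElem?_of_lt (hr.writes_getElem?_of_prop he) hlt

theorem isCut_of_rfm (hr : r.IsRunOf P) {v : Val} (he : r.ev t (.proc i) = .rfm x v)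
    (hnil : restrict ((ρ.tso (ρ.pos (.proc i) t)).buf i) x = []) :
    ρ.IsCut x (ρ.pos (.proc i) t) t := by
  intro b u hb
  rcases lt_trichotomy u t with hlt | rfl | hlt
  · refine iff_of_true ?_ hlt
    by_cases hbi : b = .disp i
    · subst hbi
      exact pos_lt_of_restrict_eq_nil hr hb hlt hnil
    · exact ρ.pos_lt_pos (hb.occursBefore_rfm hbi he hlt)
  · exact (hr.not_stores_of_rfm he hb).elim
  · exact iff_of_false (ρ.pos_lt_pos (hb.rfm_occursBefore he hlt)).not_gt hlt.not_gt

section Enabled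

variable (ρ) {v : Val}

theorem buf_tso_eq_nil (hr : r.IsRunOf P) (hf : (r.ev t (.proc i)).isFenceOrRMW = true)
    (hnil : (r.state t).tso.buf i = []) : (ρ.tso (ρ.pos (.proc i) t)).buf i = [] := by
  rw [buf_tso _ hr, localTime_pos, List.drop_eq_nil_iff, Run.length_writes,
    ← hr.numProps_add_length_buf, hnil, List.length_nil, add_zero]
  exact count_le_of_forall_count_lt fun u hut hprop =>
    Run.numProps_lt hprop (ρ.lt_localTime.2 (ρ.pos_lt_pos (.fence i u t hut hprop hf)))

theorem getLast?_restrict_of_rfb (hr : r.IsRunOf P) (hsep : r.BufferReadsSeparate)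
    (he : r.ev t (.proc i) = .rfb x v) :
    (restrict ((ρ.tso (ρ.pos (.proc i) t)).buf i) x).getLast? = some (x, v) := by
  have hen := hr.enabled t (.proc i)
  rw [he, Enabled] at hen
  obtain ⟨β₁, β₂, hβ, hβ₂⟩ := getLast?_restrict_eq_some_iff.1 hen
  have hle := ρ.numProps_localTime_le_of_hasTag hsep (Event.isRfB_iff.2 ⟨x, v, he⟩)
    (.rfb i t x v β₁ β₂ he hβ hβ₂) (Nat.le_add_right _ _)
  have hwrites : r.writes i t =
      ((r.writes i t).take (r.numProps i t) ++ β₁) ++ (x, v) :: β₂ := by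
    rw [List.append_assoc, ← hβ, hr.buf_eq, List.take_append_drop]
  have hlen : ((r.writes i t).take (r.numProps i t)).length = r.numProps i t :=
    List.length_take_of_le (r.length_writes i t ▸ hr.numProps_le_numWrites i t)
  rw [buf_tso _ hr, localTime_pos, hwrites, List.drop_append_of_le_length
    (by rwa [List.length_append, hlen])]
  exact getLast?_restrict_eq_some_iff.2 ⟨_, β₂, rfl, hβ₂⟩

theorem getLast?_restrict_of_rfm (hr : r.IsRunOf P) (he : r.ev t (.proc i) = .rfm x v)
    (hne : restrict ((ρ.tso (ρ.pos (.proc i) t)).buf i) x ≠ []) :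
    (restrict ((ρ.tso (ρ.pos (.proc i) t)).buf i) x).getLast? = some (x, v) := by
  have hen := hr.enabled t (.proc i)
  rw [he, Enabled] at hen
  obtain ⟨w, hlast⟩ := exists_getLast?_restrict_eq_some hne
  obtain ⟨β₁, β₂, hβ, hβ₂⟩ := getLast?_restrict_eq_some_iff.1 hlast
  set q := r.numProps i (ρ.localTime (.disp i) (ρ.pos (.proc i) t)) with hq
  have hqt : q ≤ r.numWrites i t := by
    simpa only [localTime_pos] using ρ.numProps_localTime_le hr i (ρ.pos (.proc i) t)
  have hwrites : r.writes i t = ((r.writes i t).take q ++ β₁) ++ (x, w) :: β₂ := by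
    rw [buf_tso _ hr, localTime_pos, ← hq] at hβ
    rw [List.append_assoc, ← hβ, List.take_append_drop]
  obtain ⟨u, hut, hprop, hcount, hlater⟩ := hr.exists_last_prop hen.1 hwrites hβ₂
  rw [List.length_append, List.length_take_of_le (r.length_writes i t ▸ hqt)] at hcount
  have hstore : r.Stores x (.disp i) u := Run.stores_disp_iff.2 ⟨w, hprop⟩
  have hpos : ρ.pos (.proc i) t ≤ ρ.pos (.disp i) u := by
    by_contra! hlt
    have := Run.numProps_lt (by rw [hprop]; rfl) (ρ.lt_localTime.2 hlt)
    omega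
  have hno : ∀ u', u + 1 ≤ u' → u' < t → ∀ b, ¬ r.Stores x b u' := by
    intro u' huu' hu't b hb
    by_cases hbi : b = .disp i
    · subst hbi
      exact hlater u' huu' hu't hb
    · exact hpos.not_gt (ρ.pos_lt_pos
        (.trans _ _ _ (hstore.occursBefore hb huu') (hb.occursBefore_rfm hbi he hu't)))
  have hmem : (r.state (u + 1)).tso.mem x = w :=
    hr.mem_succ_of_storedVal (storedVal_disp_eq_some.2 hprop)
  rw [hlast, ← hen.2, hr.mem_eq_of_forall_not_stores hut hno, hmem]

theorem enabled_forward_proc (hr : r.IsRunOf P) (hsep : r.BufferReadsSeparate) (i : Fin n)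
    (t : ℕ) :
    Enabled (ρ.tso (ρ.pos (.proc i) t)) (.proc i)
      (forward (ρ.tso (ρ.pos (.proc i) t)) (.proc i) (r.ev t (.proc i))) := by
  have hen := hr.enabled t (.proc i)
  cases he : r.ev t (.proc i) with
  | rfm x v =>
    rw [he] at hen
    rcases eq_or_ne (restrict ((ρ.tso (ρ.pos (.proc i) t)).buf i) x) [] with hnil | hne
    · rw [forward_rfm_of_eq_nil hnil]
      exact ⟨hnil, ((isCut_of_rfm hr he hnil).mem_eq hr).trans hen.2⟩
    · rw [forward_rfm_of_ne_nil hne]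
      exact ρ.getLast?_restrict_of_rfm hr he hne
  | rfb x v => exact ρ.getLast?_restrict_of_rfb hr hsep he
  | fence =>
    rw [he] at hen
    exact ρ.buf_tso_eq_nil hr (by rw [he]; rfl) hen
  | rmw x v w =>
    rw [he] at hen
    exact ⟨ρ.buf_tso_eq_nil hr (by rw [he]; rfl) hen.1,
      ((isCut_of_stores hr (Run.stores_rmw he)).mem_eq hr).trans hen.2⟩
  | prop x v =>
    rw [he] at hen
    exact hen.elim
  | _ => trivial

theorem enabled_disp (hr : r.IsRunOf P) (i : Fin n) (t : ℕ) :
    Enabled (ρ.tso (ρ.pos (.disp i) t)) (.disp i) (r.ev t (.disp i)) := by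
  have hen := hr.enabled t (.disp i)
  cases he : r.ev t (.disp i) with
  | null => trivial
  | prop x v =>
    rw [Enabled, buf_tso _ hr, localTime_pos, List.head?_drop]
    exact Run.writes_getElem?_of_lt (hr.writes_getElem?_of_prop he)
      (ρ.numProps_lt_numWrites_localTime hr (by rw [he]; rfl) le_rfl)
  | _ =>
    rw [he] at hen
    exact hen.elim

theorem enabled_run (hr : r.IsRunOf P) (hsep : r.BufferReadsSeparate) (T : ℕ) (b : Agent n) :
    Enabled (ρ.tso T) b (ρ.run.ev T b) := by
  by_cases ha : ρ.Active b T
  · obtain ⟨t, rfl⟩ := ha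
    rw [run_ev_pos]
    cases b with
    | proc i => exact ρ.enabled_forward_proc hr hsep i t
    | disp i => exact ρ.enabled_disp hr i t
  · rw [run_ev_of_not_active _ ha]
    cases b <;> trivial

end Enabled

section IsRunOf

variable (ρ)

theorem run_loc (i : Fin n) (T : ℕ) :
    (ρ.run.state T).loc i = (r.state (ρ.localTime (.proc i) T)).loc i := rfl

theorem run_ev_pos_eq_ret_iff {O : Op} :
    ρ.run.ev (ρ.pos (.proc i) t) (.proc i) = .ret O ↔ r.ev t (.proc i) = .ret O := by
  rw [run_ev_pos, forward_eq_ret_iff]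

theorem run_one_pending (hr : r.IsRunOf P) {O : Op} {T' : ℕ} (hT : T < T')
    (hinv : ρ.run.inv T i = some O) (hinv' : ρ.run.inv T' i ≠ none) :
    ∃ τ, T < τ ∧ τ ≤ T' ∧ ρ.run.ev τ (.proc i) = .ret O := by
  obtain ⟨t, rfl⟩ := ρ.active_of_run_inv_ne_none (i := i) (T := T) (by simp [hinv])
  obtain ⟨t', rfl⟩ := ρ.active_of_run_inv_ne_none hinv'
  rw [run_inv_pos] at hinv hinv'
  obtain ⟨τ, htτ, hτt', hret⟩ :=
    hr.one_pending i O t t' ((ρ.pos_strictMono _).lt_iff_lt.1 hT) hinv hinv'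
  exact ⟨ρ.pos (.proc i) τ, ρ.pos_strictMono _ htτ, (ρ.pos_strictMono _).monotone hτt',
    ρ.run_ev_pos_eq_ret_iff.2 hret⟩

theorem isRunOf_run (hr : r.IsRunOf P) (hsep : r.BufferReadsSeparate) : ρ.run.IsRunOf P where
  init_buf := hr.init_buf
  init_loc i := by rw [run_loc, localTime_zero, hr.init_loc]
  enabled := ρ.enabled_run hr hsep
  no_conflict T _ _ hbc := ρ.run_no_conflict hr T hbc
  step_tso _ := rfl
  step_loc T i := by
    rw [run_loc, run_loc]
    by_cases ha : ρ.Active (.proc i) T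
    · obtain ⟨t, rfl⟩ := ha
      rw [localTime_succ_pos, localTime_pos, hr.step_loc, run_ev_pos, record_forward, run_inv_pos]
    · rw [localTime_succ_of_not_active _ ha, run_ev_of_not_active _ ha,
        run_inv_of_not_active _ ha]
      simp [Event.record]
  follows T i h := by
    obtain ⟨t, rfl⟩ := ρ.active_of_run_ev_ne_null h
    rw [run_ev_pos] at h ⊢
    rw [run_loc, localTime_pos, action_forward]
    exact hr.follows t i (mt forward_eq_null_iff.2 h)
  one_pending _ _ _ _ hT hinv hinv' := ρ.run_one_pending hr hT hinv hinv'

theorem bufferReadsSeparate_run (hr : r.IsRunOf P) (hsep : r.BufferReadsSeparate) :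
    ρ.run.BufferReadsSeparate := by
  refine Run.bufferReadsSeparate_iff.2 fun i T x v β he hprop hβ => ?_
  obtain ⟨t, rfl⟩ := ρ.active_of_run_ev_ne_null (b := .proc i) (T := T) (by simp [he])
  obtain ⟨t', htt', hprop'⟩ := ρ.run_disp_isProp_iff.1 hprop
  obtain rfl := ρ.eq_of_pos_eq htt'
  have hbuf : (ρ.tso (ρ.pos (.proc i) t')).buf i = (r.state t').tso.buf i := by
    rw [buf_tso _ hr, localTime_pos, ← htt', localTime_pos, hr.buf_eq]
  rw [run_ev_pos, forward_proc_of_enabled hbuf (hr.enabled t' _)] at he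
  exact Run.bufferReadsSeparate_iff.1 hsep i t' x v β he hprop' (hbuf.symm.trans hβ)

theorem run_state_zero : ρ.run.state 0 = r.state 0 :=
  GlobalState.ext rfl (funext fun i => by rw [run_loc, localTime_zero])

theorem locallyEquivalent_run : r.LocallyEquivalent ρ.run := by
  intro j l
  constructor
  · rintro ⟨t, rfl⟩
    exact ⟨ρ.pos (.proc j) t, by rw [run_loc, localTime_pos]⟩
  · rintro ⟨T, rfl⟩
    exact ⟨ρ.localTime (.proc j) T, rfl⟩

theorem run_inv_isSome_iff :
    (ρ.run.inv T i).isSome = true ↔ ∃ t, ρ.pos (.proc i) t = T ∧ (r.inv t i).isSome = true := by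
  constructor
  · intro h
    obtain ⟨t, rfl⟩ := ρ.active_of_run_inv_ne_none (Option.isSome_iff_ne_none.1 h)
    exact ⟨t, rfl, by rwa [run_inv_pos] at h⟩
  · rintro ⟨t, rfl, h⟩
    rwa [run_inv_pos]

theorem occursBetween_run {X : Operation n Op} {s τ : ℕ} (hX : X.OccursBetween r s (τ + 1)) :
    X.OccursBetween ρ.run (ρ.pos (.proc X.proc) s) (ρ.pos (.proc X.proc) τ + 1) := by
  obtain ⟨hinv, hindex, τ, hsτ, hτ, hret, hfirst⟩ := hX
  obtain rfl := Nat.succ_injective hτ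
  refine ⟨by rw [run_inv_pos, hinv], ?_, ρ.pos (.proc X.proc) _, ρ.pos_strictMono _ hsτ, rfl,
    ρ.run_ev_pos_eq_ret_iff.2 hret, fun T hsT hTτ hretT => ?_⟩
  · rw [← hindex, ρ.count_eq (fun _ => ρ.run_inv_isSome_iff), localTime_pos]
  · obtain ⟨t, rfl⟩ := ρ.active_of_run_ev_ne_null (b := .proc X.proc) (T := T) (by simp [hretT])
    exact hfirst t ((ρ.pos_strictMono _).lt_iff_lt.1 hsT) ((ρ.pos_strictMono _).lt_iff_lt.1 hTτ)
      (ρ.run_ev_pos_eq_ret_iff.1 hretT)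

end IsRunOf

end Run

section Shift

variable {D K : ℕ}

/-- From time `K` of `r` on, the rescheduling only delays all nodes by `D`. -/
def IsShiftFrom (D K : ℕ) : Prop := ∀ b t, K ≤ t → ρ.pos b t = D + t

namespace IsShiftFrom

variable {ρ} (h : ρ.IsShiftFrom D K)
include h

theorem localTime_add (b : Agent n) (ht : K ≤ t) : ρ.localTime b (D + t) = t := by
  rw [← h b t ht, localTime_pos]

variable [DecidableEq Var] {P : Protocol n Var Val Op Intl}

theorem isCut_add (x : Var) (ht : K ≤ t) : ρ.IsCut x (D + t) t := fun b u _ => by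
  rw [← lt_localTime, h.localTime_add b ht]

theorem tso_add (hr : r.IsRunOf P) (ht : K ≤ t) : ρ.tso (D + t) = (r.state t).tso := by
  refine MemState.ext (funext fun x => (h.isCut_add x ht).mem_eq hr) (funext fun i => ?_)
  rw [buf_tso _ hr, h.localTime_add _ ht, h.localTime_add _ ht, hr.buf_eq]

theorem canMove_add_iff (hr : r.IsRunOf P) (i : Fin n) (ht : K ≤ t) :
    ρ.run.CanMove P i (D + t) ↔ r.CanMove P i t := by
  have htso : (ρ.run.state (D + t)).tso = (r.state t).tso := h.tso_add hr ht
  rw [Run.CanMove, Run.CanMove, htso, run_loc, h.localTime_add _ ht]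

theorem procFair (hr : r.IsRunOf P) (hfair : r.ProcFair P) : ρ.run.ProcFair P := by
  intro i T hT
  obtain ⟨t, ht, hne⟩ := hfair i (K + T) fun t ht =>
    (h.canMove_add_iff hr i (le_of_add_le_left ht)).1
      (hT _ (le_add_left (le_of_add_le_right ht)))
  refine ⟨D + t, le_add_left (le_of_add_le_right ht), ?_⟩
  rw [← h (.proc i) t (le_of_add_le_left ht), run_ev_pos]
  exact mt forward_eq_null_iff.1 hne

theorem propFair (hr : r.IsRunOf P) (hsep : r.BufferReadsSeparate) (hfair : r.PropFair) :
    ρ.run.PropFair := by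
  intro i T hT
  by_contra! hno
  have hne : (ρ.tso (D + (K + T))).buf i ≠ [] :=
    (ρ.isRunOf_run hr hsep).buf_ne_nil_of_forall_not_isProp (by omega) hT fun u hu _ =>
      Bool.eq_false_iff.2 (hno u hu)
  rw [h.tso_add hr (Nat.le_add_right K T)] at hne
  obtain ⟨t, ht, hprop⟩ := hfair i _ hne
  exact hno (D + t) (by omega)
    (ρ.run_disp_isProp_iff.2 ⟨t, h _ t (le_of_add_le_left ht), hprop⟩)

end IsShiftFrom

end Shift

end Reordering

namespace Run

variable {n : ℕ} {Var Val Op Intl : Type*} (r : Run n Var Val Op Intl) (i : Fin n) (s e : ℕ)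

/-- The node `θ` is at time `e` or earlier, and is neither `⟨i, s⟩` nor preceded by it in the
occurs-before relation, so that it may be moved to before the interval of process `i` from `s` to
`e`. -/
def Unaffected (θ : Agent n × ℕ) : Prop :=
  θ.2 ≤ e ∧ θ ≠ (.proc i, s) ∧ ¬ r.OccursBefore (.proc i, s) θ

open Classical in
/-- The phase of a node in the rescheduling that isolates the interval of process `i` from `s` to
`e`: `0` for the unaffected nodes, `1` for those of the others that the end `⟨i, e⟩` depends on, and
`2` for the rest. -/
noncomputable def phase (θ : Agent n × ℕ) : ℕ :=
  if r.Unaffected i s e θ then 0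
  else if r.OccursBefore θ (.proc i, e) then 1
  else 2

variable {r i s e} {θ θ' : Agent n × ℕ}

theorem Unaffected.of_occursBefore (h : r.OccursBefore θ θ') (hθ' : r.Unaffected i s e θ') :
    r.Unaffected i s e θ := by
  obtain ⟨hle, -, hnot⟩ := hθ'
  refine ⟨h.time_lt.le.trans hle, ?_, fun hs => hnot (.trans _ _ _ hs h)⟩
  rintro rfl
  exact hnot h

theorem phase_eq_one_iff :
    r.phase i s e θ = 1 ↔ ¬ r.Unaffected i s e θ ∧ r.OccursBefore θ (.proc i, e) := by
  unfold phase
  split_ifs <;> simp [*]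

theorem phase_le_two : r.phase i s e θ ≤ 2 := by
  unfold phase
  split_ifs <;> decide

theorem phase_mono (h : r.OccursBefore θ θ') : r.phase i s e θ ≤ r.phase i s e θ' := by
  have hend : r.OccursBefore θ' (.proc i, e) → r.OccursBefore θ (.proc i, e) := .trans _ _ _ h
  have hunaffected := Unaffected.of_occursBefore (i := i) (s := s) (e := e) h
  unfold phase
  split_ifs <;> first | decide | tauto

theorem time_le_of_phase_lt_two (h : r.phase i s e θ < 2) : θ.2 ≤ e := by
  unfold phase at h
  split_ifs at h with h₀ h₁
  · exact h₀.1
  · exact h₁.time_lt.le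
  · exact (lt_irrefl _ h).elim

theorem phase_proc_eq_one {t : ℕ} (hst : s ≤ t) (hte : t < e) :
    r.phase i s e (.proc i, t) = 1 := by
  refine phase_eq_one_iff.2 ⟨fun ⟨_, hne, hnot⟩ => ?_, .locality _ _ _ hte⟩
  rcases hst.eq_or_lt with rfl | hst
  · exact hne rfl
  · exact hnot (.locality _ _ _ hst)

theorem feedbackLoop_of_phase_eq_one {b : Agent n} {t : ℕ} (hbi : b ≠ .proc i) (hbd : b ≠ .disp i)
    (h : r.phase i s e (b, t) = 1) : r.FeedbackLoop i s e := by
  obtain ⟨haffected, hend⟩ := phase_eq_one_iff.1 h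
  refine ⟨b, t, hbi, hbd, ?_, hend⟩
  by_contra hstart
  exact haffected ⟨hend.time_lt.le, fun hθ => hbi (congrArg Prod.fst hθ), hstart⟩

theorem phase_mul_add_lt (h : r.phase i s e θ < r.phase i s e θ') :
    r.phase i s e θ * (e + 1) + θ.2 < r.phase i s e θ' * (e + 1) + θ'.2 := by
  have htime := time_le_of_phase_lt_two (h.trans_le phase_le_two)
  calc r.phase i s e θ * (e + 1) + θ.2
      < (r.phase i s e θ + 1) * (e + 1) := by linarith
    _ ≤ r.phase i s e θ' * (e + 1) := Nat.mul_le_mul_right _ h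
    _ ≤ r.phase i s e θ' * (e + 1) + θ'.2 := Nat.le_add_right _ _

theorem phase_eq_of_mul_add_eq
    (h : r.phase i s e θ * (e + 1) + θ.2 = r.phase i s e θ' * (e + 1) + θ'.2) :
    r.phase i s e θ = r.phase i s e θ' := by
  rcases lt_trichotomy (r.phase i s e θ) (r.phase i s e θ') with hlt | heq | hgt
  · exact ((phase_mul_add_lt hlt).ne h).elim
  · exact heq
  · exact ((phase_mul_add_lt hgt).ne' h).elim

variable (r i s e)

/-- The rescheduling that carries out the phases one after the other, and each of them in the order
of `r`. Phases `0` and `1` contain no node later than `e`, so each takes at most `e + 1` rounds. -/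
noncomputable def isolate : Reordering r where
  pos b t := r.phase i s e (b, t) * (e + 1) + t
  pos_lt_pos h := add_lt_add_of_le_of_lt (Nat.mul_le_mul_right _ (phase_mono h)) h.time_lt
  eq_of_pos_eq h := by rwa [phase_eq_of_mul_add_eq h, Nat.add_left_cancel_iff] at h

theorem isolate_pos (b : Agent n) (t : ℕ) :
    (r.isolate i s e).pos b t = r.phase i s e (b, t) * (e + 1) + t := rfl

theorem isShiftFrom_isolate : (r.isolate i s e).IsShiftFrom (2 * (e + 1)) (e + 1) := by
  intro b t ht
  have hphase : r.phase i s e (b, t) = 2 :=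
    phase_le_two.eq_of_not_lt fun hlt => (time_le_of_phase_lt_two hlt).not_gt ht
  rw [isolate_pos, hphase]

variable {r i s e}

theorem isolate_pos_proc {t : ℕ} (hst : s ≤ t) (hte : t < e) :
    (r.isolate i s e).pos (.proc i) t = e + 1 + t := by
  rw [isolate_pos, phase_proc_eq_one hst hte, one_mul]

theorem phase_eq_one_of_isolate_pos {b : Agent n} {t : ℕ} (hle : e + 1 ≤ (r.isolate i s e).pos b t)
    (hlt : (r.isolate i s e).pos b t < 2 * (e + 1)) : r.phase i s e (b, t) = 1 := by
  rw [isolate_pos] at hle hlt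
  have hne_two : r.phase i s e (b, t) ≠ 2 := fun h => by
    rw [h] at hlt
    omega
  have hlt_two := phase_le_two.lt_of_ne hne_two
  have hne_zero : r.phase i s e (b, t) ≠ 0 := fun h => by
    have htime : t ≤ e := time_le_of_phase_lt_two hlt_two
    rw [h] at hle
    omega
  omega

theorem soloBetween_isolate [DecidableEq Var] (hloop : ¬ r.FeedbackLoop i s e) :
    (r.isolate i s e).run.SoloBetween i (e + 1 + s) (e + 1 + e) := by
  intro T hsT hTe b hbi hbd
  by_contra hne
  obtain ⟨t, rfl⟩ := (r.isolate i s e).active_of_run_ev_ne_null hne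
  exact hloop (feedbackLoop_of_phase_eq_one hbi hbd
    (phase_eq_one_of_isolate_pos (t := t) (by omega) (by omega)))

theorem occursBetween_isolate [DecidableEq Var] {X : Operation n Op}
    (hX : X.OccursBetween r s e) :
    X.OccursBetween (r.isolate X.proc s e).run (e + 1 + s) (e + 1 + e) := by
  obtain ⟨τ, hsτ, rfl, -⟩ := hX.2.2
  have hocc := (r.isolate X.proc s (τ + 1)).occursBetween_run hX
  rwa [isolate_pos_proc le_rfl (by omega), isolate_pos_proc hsτ.le τ.lt_succ_self] at hocc

end Run

end TSO

theorem mainTheorem2 {n : ℕ} {Var Val Op Intl : Type*} [DecidableEq Var]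
    (P : TSO.Protocol n Var Val Op Intl) (r : TSO.Run n Var Val Op Intl)
    (hr : r.IsRunOf P) (hsep : r.BufferReadsSeparate)
    (X : TSO.Operation n Op) (s e : ℕ) (hX : X.OccursBetween r s e)
    (hloop : ¬ r.FeedbackLoop X.proc s e) :
    ∃ (r' : TSO.Run n Var Val Op Intl) (s' e' : ℕ),
      r'.IsRunOf P ∧ r'.BufferReadsSeparate ∧ r'.state 0 = r.state 0 ∧
      (r.PropFair → r'.PropFair) ∧ (r.ProcFair P → r'.ProcFair P) ∧
      r.LocallyEquivalent r' ∧
      X.OccursBetween r' s' e' ∧ r'.SoloBetween X.proc s' e' := by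
  let ρ := r.isolate X.proc s e
  have hshift : ρ.IsShiftFrom (2 * (e + 1)) (e + 1) := r.isShiftFrom_isolate X.proc s e
  exact ⟨ρ.run, e + 1 + s, e + 1 + e, ρ.isRunOf_run hr hsep, ρ.bufferReadsSeparate_run hr hsep,
    ρ.run_state_zero, hshift.propFair hr hsep, hshift.procFair hr, ρ.locallyEquivalent_run,
    TSO.Run.occursBetween_isolate hX, TSO.Run.soloBetween_isolate hloop⟩
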